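/- Let $\mathbb D$ be the open unit disk and let $H^2$ be the Hardy space of all functions $f(z)=\sum_{n\ge 0}a_nz^n$ on $\mathbb D$ with $\|f\|^2=\sum_{n\ge 0}|a_n|^2<\infty$. Let $p\in\mathbb D\setminus\{0\}$ and let $\lambda\in\mathbb C$ be the number with $|\lambda|=1$ and $\lambda p=\bar p$. Put $$\xi_p(z)=\frac{\sqrt{1-|p|^2}}{1-\bar p z},\qquad \tau_p(z)=\frac{\lambda(p-z)}{1-\bar p z},\qquad (W_{\xi_p,\tau_p}f)(z)=\xi_p(z)f(\tau_p(z)),\qquad (Jf)(z)=\overline{f(\bar z)},$$ so that $JW_{\xi_p,\tau_p}$ is a conjugation on $H^2$, that is, a conjugate-linear map $C$ with $C^2=I$ and $\langle Cf,Cg\rangle=\langle g,f\rangle$ for all $f,g\in H^2$. A bounded linear operator $T$ on $H^2$ is called $C$-normal, for a conjugation $C$, if $CT^*TC=TT^*$. Let $a,b,c,d\in\mathbb C$ with $ad-bc\neq 0$ be such that $\varphi(z)=\frac{az+b}{cz+d}$ is a linear fractional self-map of $\mathbb D$ (in particular $cz+d\ne 0$ on $\mathbb D$), and suppose that $\varphi(0)=0$.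 Let $C_\varphi f=f\circ\varphi$ be the (bounded) composition operator on $H^2$. Then $C_\varphi$ is $JW_{\xi_p,\tau_p}$-normal if and only if $C_\varphi$ is an isometry; moreover, $C_\varphi$ is an isometry if and only if there is $\alpha\in\mathbb C$ with $|\alpha|=1$ such that $\varphi(z)=\alpha z$ for all $z\in\mathbb D$. -/

import Mathlib

open scoped ComplexConjugate InnerProductSpace ENNReal Complex.UnitDisc

noncomputable section

namespace HardyDisc

/-- Square-summable complex sequences. -/
abbrev SqSum : Type := lp (fun _ : ℕ => ℂ) 2

theorem SqSum.summable_sq (a : SqSum) : Summable fun n => ‖a n‖ ^ 2 := by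
  have := (lp.memℓp a).summable (by norm_num)
  simpa using this

theorem SqSum.norm_sq (a : SqSum) : ‖a‖ ^ 2 = ∑' n, ‖a n‖ ^ 2 := by
  have := lp.norm_rpow_eq_tsum (p := 2) (by norm_num) a
  simpa using this

theorem SqSum.memℓp_of_summable {a : ℕ → ℂ} (h : Summable fun n => ‖a n‖ ^ 2) :
    Memℓp a 2 := by
  apply memℓp_gen
  simpa using h

theorem SqSum.norm_apply_le (a : SqSum) (n : ℕ) : ‖a n‖ ≤ ‖a‖ :=
  lp.norm_apply_le_norm (by norm_num) a n

theorem SqSum.summable_pow (a : SqSum) {w : ℂ} (hw : ‖w‖ < 1) :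
    Summable fun n => a n * w ^ n := by
  apply Summable.of_norm_bounded (g := fun n => ‖a‖ * ‖w‖ ^ n)
  · exact (summable_geometric_of_lt_one (norm_nonneg _) hw).mul_left _
  · intro n
    rw [norm_mul, norm_pow]
    gcongr
    exact a.norm_apply_le n

/-- The sum of the power series with coefficient sequence `a`, on the unit disc. -/
def powerSum : SqSum →ₗ[ℂ] (𝔻 → ℂ) where
  toFun a z := ∑' n, a n * (z : ℂ) ^ n
  map_add' a b := by
    funext z
    simp only [lp.coeFn_add, Pi.add_apply, add_mul]
    exact (a.summable_pow z.norm_lt_one).tsum_add (b.summable_pow z.norm_lt_one)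
  map_smul' c a := by
    funext z
    simp only [lp.coeFn_smul, Pi.smul_apply, smul_eq_mul, mul_assoc, RingHom.id_apply]
    exact tsum_mul_left

theorem powerSum_apply (a : SqSum) (z : 𝔻) : powerSum a z = ∑' n, a n * (z : ℂ) ^ n := rfl

theorem hasSum_powerSum (a : SqSum) (z : 𝔻) :
    HasSum (fun n => a n * (z : ℂ) ^ n) (powerSum a z) :=
  (a.summable_pow z.norm_lt_one).hasSum

theorem powerSum_injective : Function.Injective powerSum := by
  rw [injective_iff_map_eq_zero]
  intro a ha
  let P : FormalMultilinearSeries ℂ ℂ ℂ := FormalMultilinearSeries.ofScalars ℂ (fun n => a n)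
  have hP : HasFPowerSeriesOnBall (fun _ : ℂ => (0 : ℂ)) P 0 1 := by
    refine ⟨?_, one_pos, ?_⟩
    · refine ENNReal.le_of_forall_nnreal_lt fun r hr => ?_
      apply FormalMultilinearSeries.le_radius_of_bound _ ‖a‖
      intro n
      have h1 : (r : ℝ) ^ n ≤ 1 := pow_le_one₀ r.2 (by exact_mod_cast hr.le)
      calc ‖P n‖ * (r : ℝ) ^ n ≤ ‖a‖ * 1 := by
            gcongr
            rw [FormalMultilinearSeries.ofScalars_norm]
            exact a.norm_apply_le n
        _ = ‖a‖ := mul_one _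
    · intro y hy
      have hyy : ‖y‖ₑ < 1 := by simpa using hy
      have hy' : ‖y‖ < 1 := by
        rw [← ofReal_norm] at hyy
        exact (ENNReal.ofReal_lt_one).1 hyy
      have := hasSum_powerSum a (Complex.UnitDisc.mk y hy')
      rw [ha] at this
      simpa [P, FormalMultilinearSeries.ofScalars_apply_eq, mul_comm] using this
  have h0 : P = 0 := hP.hasFPowerSeriesAt.eq_zero
  ext n
  have := congrArg (fun Q => FormalMultilinearSeries.coeff Q n) h0
  rw [FormalMultilinearSeries.coeff_ofScalars] at this
  rw [this]
  simp [FormalMultilinearSeries.coeff]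

/-- The left shift on square-summable sequences. -/
def leftShift : SqSum →L[ℂ] SqSum :=
  LinearMap.mkContinuous
    { toFun := fun a => ⟨fun n => a (n + 1),
        SqSum.memℓp_of_summable ((summable_nat_add_iff 1).2 a.summable_sq)⟩
      map_add' := fun _ _ => rfl
      map_smul' := fun _ _ => rfl } 1 (by
    intro a
    rw [one_mul]
    refine le_of_sq_le_sq ?_ (norm_nonneg _)
    rw [SqSum.norm_sq, SqSum.norm_sq a, a.summable_sq.tsum_eq_zero_add]
    exact le_add_of_nonneg_left (sq_nonneg _))

theorem leftShift_apply (a : SqSum) (n : ℕ) : leftShift a n = a (n + 1) := rfl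

theorem leftShift_norm_sq (a : SqSum) : ‖leftShift a‖ ^ 2 = ‖a‖ ^ 2 - ‖a 0‖ ^ 2 := by
  rw [SqSum.norm_sq, SqSum.norm_sq a, a.summable_sq.tsum_eq_zero_add]
  simp [leftShift_apply]

theorem norm_leftShift_le : ‖leftShift‖ ≤ 1 :=
  LinearMap.mkContinuous_norm_le _ zero_le_one _

theorem exists_majorant (a : SqSum) :
    ∃ P : ℂ → ℂ, DifferentiableOn ℂ P (Metric.ball 0 1) ∧
      ∀ z : 𝔻, ‖powerSum a z‖ ^ 2 ≤ (P z).re := by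
  have hunit : ∀ w ∈ Metric.ball (0 : ℂ) 1, IsUnit (1 - w • leftShift) := by
    intro w hw
    apply isUnit_one_sub_of_norm_lt_one
    rw [norm_smul]
    have : ‖w‖ < 1 := by simpa using hw
    nlinarith [norm_leftShift_le, norm_nonneg w, norm_nonneg leftShift]
  let R : ℂ → (SqSum →L[ℂ] SqSum) := fun w => Ring.inverse (1 - w • leftShift)
  refine ⟨fun w => innerSL ℂ a (((1 + w • leftShift) * R w) a), ?_, ?_⟩
  · intro w hw
    have hR : DifferentiableAt ℂ R w :=
      by
      have h1 : DifferentiableAt ℂ (fun w : ℂ => 1 - w • leftShift) w := by fun_prop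
      exact (differentiableAt_inverse (𝕜 := ℂ) (hunit w hw)).comp w h1
    have h2 : DifferentiableAt ℂ (fun w : ℂ => (1 + w • leftShift) * R w) w :=
      DifferentiableAt.mul (by fun_prop) hR
    have h3 : DifferentiableAt ℂ (fun w : ℂ => ((1 + w • leftShift) * R w) a) w :=
      h2.clm_apply (differentiableAt_const a)
    exact ((innerSL ℂ a).differentiableAt.comp w h3).differentiableWithinAt
  · intro z
    have hz : (z : ℂ) ∈ Metric.ball (0 : ℂ) 1 := by simpa using z.norm_lt_one
    set F : SqSum := R z a with hF
    have hfix : F - (z : ℂ) • leftShift F = a := by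
      have := Ring.mul_inverse_cancel _ (hunit z hz)
      have := congrArg (fun T : SqSum →L[ℂ] SqSum => T a) this
      simpa [R, hF] using this
    have hrec : ∀ n, F n = a n + z * F (n + 1) := by
      intro n
      have := congrArg (fun b : SqSum => b n) hfix
      change F n - z * F (n + 1) = a n at this
      rw [← this]; ring
    have hsum : ∀ N : ℕ, F 0 = (∑ k ∈ Finset.range N, a k * (z : ℂ) ^ k) + (z : ℂ) ^ N * F N := by
      intro N
      induction N with
      | zero => simp
      | succ N ih => rw [Finset.sum_range_succ, ih, hrec N]; ring
    have hF0 : F 0 = powerSum a z := by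
      have h1 := (hasSum_powerSum a z).tendsto_sum_nat
      have h2 : Filter.Tendsto (fun N : ℕ => (z : ℂ) ^ N * F N) Filter.atTop (nhds 0) := by
        apply squeeze_zero_norm (a := fun N : ℕ => ‖(z : ℂ)‖ ^ N * ‖F‖)
        · intro N
          rw [norm_mul, norm_pow]
          gcongr
          exact F.norm_apply_le N
        · simpa using (tendsto_pow_atTop_nhds_zero_of_lt_one (norm_nonneg _)
            z.norm_lt_one).mul_const ‖F‖
      have h3 := h1.add h2
      simp only [← hsum, add_zero] at h3
      exact tendsto_nhds_unique tendsto_const_nhds h3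
    have hP : (innerSL ℂ a (((1 + (z : ℂ) • leftShift) * R z) a)).re
        = ‖F‖ ^ 2 - ‖(z : ℂ) • leftShift F‖ ^ 2 := by
      have : ((1 + (z : ℂ) • leftShift) * R z) a = F + (z : ℂ) • leftShift F := by
        simp [hF]
      rw [this, innerSL_apply_apply, ← hfix]
      set G := (z : ℂ) • leftShift F
      rw [inner_sub_left, inner_add_right, inner_add_right]
      have h1 : (⟪F, F⟫_ℂ).re = ‖F‖ ^ 2 := by
        rw [inner_self_eq_norm_sq_to_K]; norm_cast
      have h2 : (⟪G, G⟫_ℂ).re = ‖G‖ ^ 2 := by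
        rw [inner_self_eq_norm_sq_to_K]; norm_cast
      have h3 : (⟪F, G⟫_ℂ).re = (⟪G, F⟫_ℂ).re := by
        rw [← inner_conj_symm F G, Complex.conj_re]
      simp only [Complex.sub_re, Complex.add_re, h1, h2, h3]
      ring
    show _ ≤ (innerSL ℂ a (((1 + (z : ℂ) • leftShift) * R z) a)).re
    rw [hP, ← hF0, norm_smul, mul_pow, leftShift_norm_sq]
    have h4 : ‖(z : ℂ)‖ ^ 2 ≤ 1 := z.sq_norm_lt_one.le
    have h5 : ‖F 0‖ ^ 2 ≤ ‖F‖ ^ 2 := by gcongr; exact F.norm_apply_le 0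
    nlinarith

theorem exists_powerSum_eq {g : ℂ → ℂ} (hg : DifferentiableOn ℂ g (Metric.ball 0 1)) {C : ℝ}
    (hC : ∀ r : ℝ, 0 < r → r < 1 → Real.circleAverage (fun z => ‖g z‖ ^ 2) 0 r ≤ C) :
    ∃ a : SqSum, ∀ z : 𝔻, powerSum a z = g z := by
  obtain ⟨a, hsum⟩ : ∃ a : ℕ → ℂ, ∀ z : ℂ, ‖z‖ < 1 → HasSum (fun n => a n * z ^ n) (g z) := by
    refine ⟨fun n => (n.factorial : ℂ)⁻¹ * iteratedDeriv n g 0, fun z hz => ?_⟩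
    have := Complex.hasSum_taylorSeries_on_ball (r := 1) (c := 0) (f := g)
      (by simpa using hg) (z := z) (by simpa using hz)
    have h : (fun n : ℕ => (n.factorial : ℂ)⁻¹ * iteratedDeriv n g 0 * z ^ n)
        = fun n : ℕ => (n.factorial : ℂ)⁻¹ • (z - 0) ^ n • iteratedDeriv n g 0 := by
      funext n
      rw [sub_zero, smul_eq_mul, smul_eq_mul]
      ring
    rw [h]
    exact this
  have hpart : ∀ r : ℝ, 0 < r → r < 1 → ∀ K : ℕ,
      ∑ n ∈ Finset.range K, ‖a n‖ ^ 2 * (r ^ n) ^ 2 ≤ C := by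
    intro r hr0 hr1 K
    have hrn : ‖(r : ℂ)‖ = r := by simp [abs_of_pos hr0]
    have hu : Summable fun n => ‖a n‖ * r ^ n := by
      have := (hsum r (by rw [hrn]; exact hr1)).summable.norm
      simpa [norm_mul, norm_pow, abs_of_pos hr0] using this
    set U := ∑' n, ‖a n‖ * r ^ n with hU
    have hU0 : 0 ≤ U := tsum_nonneg fun n => by positivity
    have hbd : ∀ n : ℕ, ∀ z ∈ Metric.sphere (0 : ℂ) r, ‖a n * z ^ n‖ ≤ ‖a n‖ * r ^ n := by
      intro n z hz
      have : ‖z‖ = r := by simpa using hz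
      rw [norm_mul, norm_pow, this]
    have hunif := tendstoUniformlyOn_tsum_nat hu hbd
    have hgU : ∀ z ∈ Metric.sphere (0 : ℂ) r, ‖g z‖ ≤ U := by
      intro z hz
      have hz' : ‖z‖ = r := by simpa using hz
      rw [← (hsum z (by rw [hz']; exact hr1)).tsum_eq]
      exact tsum_of_norm_bounded hu.hasSum fun n => hbd n z hz
    have hpU : ∀ N : ℕ, ∀ z ∈ Metric.sphere (0 : ℂ) r,
        ‖∑ n ∈ Finset.range N, a n * z ^ n‖ ≤ U := by
      intro N z hz
      refine (norm_sum_le_of_le _ fun n _ => hbd n z hz).trans ?_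
      exact hu.sum_le_tsum _ fun n _ => by positivity
    have hgc : ContinuousOn g (Metric.sphere 0 |r|) := by
      rw [abs_of_pos hr0]
      exact hg.continuousOn.mono fun z hz => by
        have : ‖z‖ = r := by simpa using hz
        simpa [this] using hr1
    have hgi : CircleIntegrable (fun z => ‖g z‖ ^ 2) 0 r :=
      ContinuousOn.circleIntegrable' (by fun_prop)
    refine le_of_forall_pos_le_add fun ε hε => ?_
    obtain ⟨N, hKN, hN⟩ : ∃ N, K ≤ N ∧ ∀ z ∈ Metric.sphere (0 : ℂ) r,
        ‖(∑ n ∈ Finset.range N, a n * z ^ n) - g z‖ ≤ ε / (2 * U + 1) := by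
      rw [Metric.tendstoUniformlyOn_iff] at hunif
      obtain ⟨N, h1, h2⟩ := ((hunif (ε / (2 * U + 1)) (by positivity)).and
        (Filter.eventually_ge_atTop K)).exists
      refine ⟨N, h2, fun z hz => ?_⟩
      have hz' : ‖z‖ = r := by simpa using hz
      have := h1 z hz
      rw [(hsum z (by rw [hz']; exact hr1)).tsum_eq, dist_comm, dist_eq_norm] at this
      exact this.le
    let Q : Polynomial ℂ := ∑ n ∈ Finset.range N, Polynomial.monomial n (a n * (r : ℂ) ^ n)
    have hQe : ∀ θ : ℂ, Q.eval θ = ∑ n ∈ Finset.range N, a n * (r * θ) ^ n := by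
      intro θ
      simp only [Q, Polynomial.eval_finsetSum, Polynomial.eval_monomial]
      exact Finset.sum_congr rfl fun n _ => by ring
    have hQc : ∀ n < N, Q.coeff n = a n * (r : ℂ) ^ n := by
      intro n hn
      simp [Q, Polynomial.coeff_monomial, hn]
    calc ∑ n ∈ Finset.range K, ‖a n‖ ^ 2 * (r ^ n) ^ 2
        ≤ ∑ n ∈ Finset.range N, ‖a n‖ ^ 2 * (r ^ n) ^ 2 :=
          Finset.sum_le_sum_of_subset_of_nonneg (Finset.range_mono hKN)
            fun n _ _ => by positivity
      _ = ∑ n ∈ Finset.range N, ‖Q.coeff n‖ ^ 2 := by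
          refine Finset.sum_congr rfl fun n hn => ?_
          rw [hQc n (Finset.mem_range.1 hn), norm_mul, norm_pow, hrn, mul_pow]
      _ ≤ ∑ n ∈ Q.support ∪ Finset.range N, ‖Q.coeff n‖ ^ 2 :=
          Finset.sum_le_sum_of_subset_of_nonneg Finset.subset_union_right
            fun n _ _ => by positivity
      _ = ∑ n ∈ Q.support, ‖Q.coeff n‖ ^ 2 := by
          symm
          refine Finset.sum_subset Finset.subset_union_left fun n _ hn => ?_
          simp [Polynomial.notMem_support_iff.1 hn]
      _ = Real.circleAverage (fun z => ‖∑ n ∈ Finset.range N, a n * z ^ n‖ ^ 2) 0 r := by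
          rw [Polynomial.sum_sq_norm_coeff_eq_circleAverage,
            Real.circleAverage_eq_circleAverage_zero_one (R := r)]
          simp only [hQe, add_zero]
      _ ≤ Real.circleAverage (fun z => ‖g z‖ ^ 2 + ε) 0 r := by
          apply Real.circleAverage_mono
          · exact ContinuousOn.circleIntegrable' (by fun_prop)
          · exact ContinuousOn.circleIntegrable' (by fun_prop)
          · intro z hz
            rw [abs_of_pos hr0] at hz
            have h1 := hN z hz
            have h2 := hgU z hz
            have h3 := hpU N z hz
            set p := ∑ n ∈ Finset.range N, a n * z ^ n
            have h4 : ‖p‖ - ‖g z‖ ≤ ε / (2 * U + 1) := (norm_sub_norm_le _ _).trans h1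
            have h5 : ε / (2 * U + 1) * (2 * U + 1) = ε := by field_simp
            have h6 : 0 < ε / (2 * U + 1) := by positivity
            nlinarith [norm_nonneg p, norm_nonneg (g z)]
      _ = Real.circleAverage (fun z => ‖g z‖ ^ 2) 0 r + ε := by
          rw [Real.circleAverage_fun_add hgi (by simp), Real.circleAverage_const]
      _ ≤ C + ε := by gcongr; exact hC r hr0 hr1
  have hpart1 : ∀ K : ℕ, ∑ n ∈ Finset.range K, ‖a n‖ ^ 2 ≤ C := by
    intro K
    have hc : Continuous fun r : ℝ => ∑ n ∈ Finset.range K, ‖a n‖ ^ 2 * (r ^ n) ^ 2 := by fun_prop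
    have ht : Filter.Tendsto (fun r : ℝ => ∑ n ∈ Finset.range K, ‖a n‖ ^ 2 * (r ^ n) ^ 2)
        (nhdsWithin 1 (Set.Iio 1)) (nhds (∑ n ∈ Finset.range K, ‖a n‖ ^ 2)) := by
      have := hc.tendsto 1
      simp only [one_pow, mul_one] at this
      exact this.mono_left nhdsWithin_le_nhds
    refine le_of_tendsto ht ?_
    filter_upwards [Ioo_mem_nhdsLT (zero_lt_one (α := ℝ))] with r hr
    exact hpart r hr.1 hr.2 K
  refine ⟨⟨a, SqSum.memℓp_of_summable
    (summable_of_sum_range_le (fun n => by positivity) hpart1)⟩, fun z => ?_⟩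
  exact (hsum z z.norm_lt_one).tsum_eq

/-- A function on the unit disc is analytic if it is the restriction of a function on the plane
that is complex differentiable on the open unit disc. -/
def IsAnalytic (f : 𝔻 → ℂ) : Prop :=
  ∃ F : ℂ → ℂ, DifferentiableOn ℂ F (Metric.ball 0 1) ∧ ∀ z : 𝔻, F z = f z

theorem isAnalytic_powerSum (a : SqSum) : IsAnalytic (powerSum a) := by
  refine ⟨fun w => ∑' n, a n * w ^ n, ?_, fun z => rfl⟩
  intro w hw
  have hw1 : ‖w‖ < 1 := by simpa using hw
  obtain ⟨r, hr, hr1⟩ := exists_between hw1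
  have hr0 : 0 ≤ r := (norm_nonneg w).trans hr.le
  have : DifferentiableOn ℂ (fun w : ℂ => ∑' n, a n * w ^ n) (Metric.ball 0 r) := by
    apply Complex.differentiableOn_tsum_of_summable_norm
      (u := fun n => ‖a‖ * r ^ n)
      ((summable_geometric_of_lt_one hr0 hr1).mul_left _)
      (fun n => by fun_prop) Metric.isOpen_ball
    intro n z hz
    have hz' : ‖z‖ ≤ r := by
      have : ‖z‖ < r := by simpa using hz
      exact this.le
    rw [norm_mul, norm_pow]
    gcongr
    exact a.norm_apply_le n
  exact (this.differentiableAt (Metric.isOpen_ball.mem_nhds (by simpa using hr))).differentiableWithinAt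

/-- An analytic self-map of the unit disc. -/
structure AnalyticSelfMap where
  toFun : 𝔻 → 𝔻
  analytic : IsAnalytic fun z => (toFun z : ℂ)

instance : CoeFun AnalyticSelfMap fun _ => 𝔻 → 𝔻 := ⟨AnalyticSelfMap.toFun⟩

/-- A bounded analytic function on the unit disc. -/
structure BoundedAnalytic where
  toFun : 𝔻 → ℂ
  analytic : IsAnalytic toFun
  bounded : ∃ B : ℝ, ∀ z, ‖toFun z‖ ≤ B

instance : CoeFun BoundedAnalytic fun _ => 𝔻 → ℂ := ⟨BoundedAnalytic.toFun⟩

theorem exists_powerSum_weighted (ψ : BoundedAnalytic) (φ : AnalyticSelfMap) (a : SqSum) :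
    ∃ b : SqSum, ∀ z : 𝔻, powerSum b z = ψ z * powerSum a (φ z) := by
  obtain ⟨Ψ, hΨ, hΨe⟩ := ψ.analytic
  obtain ⟨Φ, hΦ, hΦe⟩ := φ.analytic
  obtain ⟨A, hA, hAe⟩ := isAnalytic_powerSum a
  obtain ⟨P, hP, hPle⟩ := exists_majorant a
  obtain ⟨B, hB⟩ := ψ.bounded
  have hB0 : 0 ≤ B := (norm_nonneg _).trans (hB 0)
  have hmaps : Set.MapsTo Φ (Metric.ball 0 1) (Metric.ball 0 1) := by
    intro w hw
    have hw' : ‖w‖ < 1 := by simpa using hw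
    have := hΦe (Complex.UnitDisc.mk w hw')
    rw [Complex.UnitDisc.coe_mk] at this
    rw [this]
    simpa using (φ (Complex.UnitDisc.mk w hw')).norm_lt_one
  have hPΦ : DifferentiableOn ℂ (fun w => P (Φ w)) (Metric.ball 0 1) := hP.comp hΦ hmaps
  have hg : DifferentiableOn ℂ (fun w => Ψ w * A (Φ w)) (Metric.ball 0 1) :=
    hΨ.mul (hA.comp hΦ hmaps)
  have key : ∀ z : 𝔻, Ψ z * A (Φ z) = ψ z * powerSum a (φ z) := by
    intro z
    rw [hΨe z, hΦe z, hAe]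
  obtain ⟨b, hb⟩ := exists_powerSum_eq (C := B ^ 2 * (P (Φ 0)).re) hg (by
    intro r hr0 hr1
    have hsub : Metric.closedBall (0 : ℂ) r ⊆ Metric.ball 0 1 :=
      Metric.closedBall_subset_ball hr1
    have hsph : Metric.sphere (0 : ℂ) |r| ⊆ Metric.ball 0 1 := by
      rw [abs_of_pos hr0]; exact Metric.sphere_subset_closedBall.trans hsub
    have hgc : ContinuousOn (fun w => Ψ w * A (Φ w)) (Metric.sphere 0 |r|) :=
      hg.continuousOn.mono hsph
    have hPc : ContinuousOn (fun w => P (Φ w)) (Metric.sphere 0 |r|) :=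
      hPΦ.continuousOn.mono hsph
    have hmean : Real.circleAverage (fun w => P (Φ w)) 0 r = P (Φ 0) := by
      apply DiffContOnCl.circleAverage
      rw [abs_of_pos hr0]
      exact (hPΦ.mono (by rw [closure_ball _ hr0.ne']; exact hsub)).diffContOnCl
    have hre : Real.circleAverage (fun w => (P (Φ w)).re) 0 r = (P (Φ 0)).re := by
      rw [← hmean]
      exact Complex.reCLM.circleAverage_comp_comm hPc.circleIntegrable'
    calc Real.circleAverage (fun w => ‖Ψ w * A (Φ w)‖ ^ 2) 0 r
        ≤ Real.circleAverage (fun w => B ^ 2 • (P (Φ w)).re) 0 r := by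
          apply Real.circleAverage_mono
          · exact ContinuousOn.circleIntegrable' (by fun_prop)
          · refine ContinuousOn.circleIntegrable' ?_
            have h0 : ContinuousOn (fun w => (P (Φ w)).re) (Metric.sphere 0 |r|) :=
              Complex.continuous_re.comp_continuousOn hPc
            exact h0.const_smul (B ^ 2)
          · intro w hw
            have hw1 : ‖w‖ < 1 := by simpa using hsph hw
            have h1 := key (Complex.UnitDisc.mk w hw1)
            have h2 := hΦe (Complex.UnitDisc.mk w hw1)
            rw [Complex.UnitDisc.coe_mk] at h1 h2
            rw [h1, norm_mul, mul_pow, smul_eq_mul, h2]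
            gcongr
            · exact hB _
            · exact hPle _
      _ = B ^ 2 * (P (Φ 0)).re := by
          rw [Real.circleAverage_fun_smul, hre, smul_eq_mul])
  exact ⟨b, fun z => (hb z).trans (key z)⟩

/-- The underlying space of functions of the Hardy space: sums on the unit disc of power series with
square-summable coefficients. -/
def hardySubmodule : Submodule ℂ (𝔻 → ℂ) where
  carrier := {f | ∃ a : ℕ → ℂ, (Summable fun n => ‖a n‖ ^ 2) ∧
    ∀ z : 𝔻, HasSum (fun n => a n * (z : ℂ) ^ n) (f z)}
  add_mem' := by
    rintro f g ⟨a, ha, hf⟩ ⟨b, hb, hg⟩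
    refine ⟨fun n => a n + b n, ?_, fun z => ?_⟩
    · refine Summable.of_nonneg_of_le (fun n => by positivity) (fun n => ?_)
        ((ha.mul_left 2).add (hb.mul_left 2))
      have h1 := norm_add_le (a n) (b n)
      have h2 : ‖a n + b n‖ ^ 2 ≤ (‖a n‖ + ‖b n‖) ^ 2 := by gcongr
      nlinarith [sq_nonneg (‖a n‖ - ‖b n‖)]
    · simp only [add_mul]
      exact (hf z).add (hg z)
  zero_mem' := ⟨0, by simp, fun z => by simp⟩
  smul_mem' := by
    rintro c f ⟨a, ha, hf⟩
    refine ⟨fun n => c * a n, ?_, fun z => ?_⟩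
    · simpa only [norm_mul, mul_pow] using ha.mul_left _
    · simp only [mul_assoc]
      exact (hf z).mul_left c

theorem powerSum_mem (a : SqSum) : powerSum a ∈ hardySubmodule :=
  ⟨a, a.summable_sq, hasSum_powerSum a⟩

/-- The Hardy space of the unit disc. -/
def HardySpace : Type := hardySubmodule

namespace HardySpace

instance : AddCommGroup HardySpace := inferInstanceAs (AddCommGroup hardySubmodule)

instance : Module ℂ HardySpace := inferInstanceAs (Module ℂ hardySubmodule)

/-- The linear bijection between square-summable sequences and the Hardy space. -/
def ofCoeffs : SqSum ≃ₗ[ℂ] HardySpace :=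
  LinearEquiv.ofBijective (powerSum.codRestrict hardySubmodule powerSum_mem)
    ⟨fun _ _ h => powerSum_injective (congrArg Subtype.val h), by
      rintro ⟨f, a, ha, hf⟩
      refine ⟨⟨a, SqSum.memℓp_of_summable ha⟩, Subtype.ext (funext fun z => ?_)⟩
      exact (hf z).tsum_eq⟩

/-- The sequence of Taylor coefficients at the origin. -/
def coeffs : HardySpace ≃ₗ[ℂ] SqSum := ofCoeffs.symm

/-- The norm of a function is the `ℓ²` norm of its sequence of Taylor coefficients. -/
instance : NormedAddCommGroup HardySpace :=
  NormedAddCommGroup.induced HardySpace SqSum coeffs coeffs.injective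

instance : InnerProductSpace ℂ HardySpace where
  inner f g := ⟪coeffs f, coeffs g⟫_ℂ
  norm_smul_le c f := by
    change ‖coeffs (c • f)‖ ≤ ‖c‖ * ‖coeffs f‖
    rw [map_smul, norm_smul]
  norm_sq_eq_re_inner f := norm_sq_eq_re_inner (𝕜 := ℂ) (coeffs f)
  conj_inner_symm f g := inner_conj_symm (coeffs f) (coeffs g)
  add_left f g h := by rw [map_add, inner_add_left]
  smul_left f g c := by rw [map_smul, inner_smul_left]

/-- `coeffs` as an isometric isomorphism. -/
def coeffsIsometry : HardySpace ≃ₗᵢ[ℂ] SqSum where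
  toLinearEquiv := coeffs
  norm_map' _ := rfl

instance : CompleteSpace HardySpace :=
  (completeSpace_congr (e := coeffsIsometry.toEquiv)
    coeffsIsometry.isometry.isUniformInducing.isUniformEmbedding).2 inferInstance

theorem hasSum_val (f : HardySpace) (z : 𝔻) :
    HasSum (fun n => coeffs f n * (z : ℂ) ^ n) (f.1 z) := by
  have h : ofCoeffs (coeffs f) = f := ofCoeffs.apply_symm_apply f
  have := hasSum_powerSum (coeffs f) z
  have h2 : f.1 z = powerSum (coeffs f) z := by
    conv_lhs => rw [← h]
    rfl
  rwa [h2]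

theorem norm_val_le (z : 𝔻) (f : HardySpace) :
    ‖f.1 z‖ ≤ (1 - ‖(z : ℂ)‖)⁻¹ * ‖f‖ := by
  rw [mul_comm, ← (hasSum_val f z).tsum_eq]
  refine tsum_of_norm_bounded
    ((hasSum_geometric_of_lt_one (norm_nonneg _) z.norm_lt_one).mul_left ‖f‖) fun n => ?_
  rw [norm_mul, norm_pow]
  gcongr
  exact (coeffs f).norm_apply_le n

/-- The evaluation of functions; it gives `f z` its meaning for `f : HardySpace` and `z : 𝔻`. -/
instance : RKHS ℂ HardySpace 𝔻 ℂ where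
  coeCLM := ContinuousLinearMap.pi fun z =>
    LinearMap.mkContinuous
      { toFun := fun f : HardySpace => f.1 z
        map_add' := fun _ _ => rfl
        map_smul' := fun _ _ => rfl } _ (norm_val_le z)
  coeCLM_injective := fun _ _ h => Subtype.ext h

/-- A function that belongs to the Hardy space, as an element of it. -/
def mk (f : 𝔻 → ℂ) (hf : f ∈ hardySubmodule) : HardySpace := ⟨f, hf⟩

theorem mk_apply (f : 𝔻 → ℂ) (hf : f ∈ hardySubmodule) (z : 𝔻) : mk f hf z = f z := rfl

theorem hasSum_apply (f : HardySpace) (z : 𝔻) :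
    HasSum (fun n => coeffs f n * (z : ℂ) ^ n) (f z) := hasSum_val f z

theorem norm_sq_eq (f : HardySpace) : ‖f‖ ^ 2 = ∑' n, ‖coeffs f n‖ ^ 2 :=
  SqSum.norm_sq (coeffs f)

end HardySpace

theorem weighted_mem (ψ : BoundedAnalytic) (φ : AnalyticSelfMap) (f : HardySpace) :
    (fun z => ψ z * f (φ z)) ∈ hardySubmodule := by
  obtain ⟨b, hb⟩ := exists_powerSum_weighted ψ φ (HardySpace.coeffs f)
  have h : (fun z => ψ z * f (φ z)) = powerSum b := by
    funext z
    rw [hb z, (HardySpace.hasSum_apply f (φ z)).unique (hasSum_powerSum _ _)]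
  rw [h]
  exact powerSum_mem b

/-- The linear map `f ↦ ψ · (f ∘ φ)` on the Hardy space. -/
def weightedCompLin (ψ : BoundedAnalytic) (φ : AnalyticSelfMap) : HardySpace →ₗ[ℂ] HardySpace where
  toFun f := HardySpace.mk (fun z => ψ z * f (φ z)) (weighted_mem ψ φ f)
  map_add' f g := RKHS.ext fun z => by
    simp only [HardySpace.mk_apply, RKHS.coe_add, Pi.add_apply, mul_add]
  map_smul' c f := RKHS.ext fun z => by
    simp only [HardySpace.mk_apply, RKHS.coe_smul, Pi.smul_apply, smul_eq_mul, RingHom.id_apply]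
    ring

/-- The weighted composition operator `f ↦ ψ · (f ∘ φ)` on the Hardy space; it is bounded. -/
def weightedComp (ψ : BoundedAnalytic) (φ : AnalyticSelfMap) : HardySpace →L[ℂ] HardySpace where
  toLinearMap := weightedCompLin ψ φ
  cont := by
    refine LinearMap.continuous_of_seq_closed_graph (weightedCompLin ψ φ) fun u f g hf hg => ?_
    refine RKHS.ext fun z => ?_
    have h1 := ((RKHS.continuous_eval (H := HardySpace) z).tendsto g).comp hg
    have h2 := (((RKHS.continuous_eval (H := HardySpace) (φ z)).tendsto f).comp hf).const_mul (ψ z)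
    exact tendsto_nhds_unique h1 h2

theorem weightedComp_apply (ψ : BoundedAnalytic) (φ : AnalyticSelfMap) (f : HardySpace) (z : 𝔻) :
    weightedComp ψ φ f z = ψ z * f (φ z) := rfl

/-- The constant function `1`. -/
def BoundedAnalytic.one : BoundedAnalytic where
  toFun _ := 1
  analytic := ⟨fun _ => 1, differentiableOn_const 1, fun _ => rfl⟩
  bounded := ⟨1, fun _ => by simp⟩

/-- The composition operator `f ↦ f ∘ φ` on the Hardy space. -/
def compositionOperator (φ : AnalyticSelfMap) : HardySpace →L[ℂ] HardySpace :=
  weightedComp BoundedAnalytic.one φ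

theorem compositionOperator_apply (φ : AnalyticSelfMap) (f : HardySpace) (z : 𝔻) :
    compositionOperator φ f z = f (φ z) := one_mul _

theorem conj_mem (f : HardySpace) : (fun z => conj (f (star z))) ∈ hardySubmodule := by
  refine ⟨fun n => conj (HardySpace.coeffs f n), ?_, fun z => ?_⟩
  · simpa using (HardySpace.coeffs f).summable_sq
  · have := (Complex.hasSum_conj' (f := fun n => _)).2 (HardySpace.hasSum_apply f (star z))
    simpa using this

/-- The map `J` with `(J f)(z) = conj (f (conj z))`. -/
def hardyConj : HardySpace →ₗ⋆[ℂ] HardySpace where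
  toFun f := HardySpace.mk (fun z => conj (f (star z))) (conj_mem f)
  map_add' f g := RKHS.ext fun z => by
    simp only [HardySpace.mk_apply, RKHS.coe_add, Pi.add_apply, map_add]
  map_smul' c f := RKHS.ext fun z => by
    simp only [HardySpace.mk_apply, RKHS.coe_smul, Pi.smul_apply, smul_eq_mul, map_mul]

theorem one_sub_conj_mul_ne_zero (p : 𝔻) {w : ℂ} (hw : ‖w‖ ≤ 1) : 1 - conj (p : ℂ) * w ≠ 0 := by
  intro h
  have h1 : ‖conj (p : ℂ) * w‖ < 1 := by
    rw [norm_mul, RCLike.norm_conj]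
    nlinarith [p.norm_lt_one, norm_nonneg (p : ℂ), norm_nonneg w]
  rw [← sub_eq_zero.1 h] at h1
  simp at h1

/-- The function `ξ_p(z) = √(1 - |p|²) / (1 - conj p * z)`. -/
def xi (p : 𝔻) : BoundedAnalytic where
  toFun z := (Real.sqrt (1 - ‖(p : ℂ)‖ ^ 2) : ℂ) / (1 - conj (p : ℂ) * z)
  analytic := by
    refine ⟨fun w => (Real.sqrt (1 - ‖(p : ℂ)‖ ^ 2) : ℂ) / (1 - conj (p : ℂ) * w), ?_,
      fun _ => rfl⟩
    intro w hw
    have hw' : ‖w‖ < 1 := by simpa using hw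
    exact DifferentiableAt.differentiableWithinAt
      (DifferentiableAt.div (by fun_prop) (by fun_prop) (one_sub_conj_mul_ne_zero p hw'.le))
  bounded := by
    refine ⟨Real.sqrt (1 - ‖(p : ℂ)‖ ^ 2) / (1 - ‖(p : ℂ)‖), fun z => ?_⟩
    have h0 : 0 < 1 - ‖(p : ℂ)‖ := sub_pos.2 p.norm_lt_one
    rw [norm_div, Complex.norm_real, Real.norm_of_nonneg (Real.sqrt_nonneg _)]
    gcongr
    have h1 : ‖(1 : ℂ)‖ - ‖conj (p : ℂ) * z‖ ≤ ‖1 - conj (p : ℂ) * z‖ := norm_sub_norm_le _ _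
    rw [norm_one, norm_mul, RCLike.norm_conj] at h1
    nlinarith [z.norm_lt_one, norm_nonneg (p : ℂ)]

theorem norm_mobius_lt_one (p : 𝔻) (lam : Circle) (z : 𝔻) :
    ‖(lam : ℂ) * (p - z) / (1 - conj (p : ℂ) * z)‖ < 1 := by
  have h0 := one_sub_conj_mul_ne_zero p z.norm_lt_one.le
  rw [norm_div, norm_mul, Circle.norm_coe, one_mul, div_lt_one (norm_pos_iff.2 h0)]
  refine lt_of_pow_lt_pow_left₀ 2 (norm_nonneg _) ?_
  have hp := p.normSq_lt_one
  have hz := z.normSq_lt_one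
  rw [← Complex.normSq_eq_norm_sq, ← Complex.normSq_eq_norm_sq]
  have key : Complex.normSq (1 - conj (p : ℂ) * z) - Complex.normSq ((p : ℂ) - z)
      = (1 - Complex.normSq p) * (1 - Complex.normSq z) := by
    simp [Complex.normSq_apply]
    ring
  nlinarith [mul_pos (sub_pos.2 hp) (sub_pos.2 hz)]

/-- The disc automorphism `τ_p(z) = λ (p - z) / (1 - conj p * z)`. -/
def tau (p : 𝔻) (lam : Circle) : AnalyticSelfMap where
  toFun z := Complex.UnitDisc.mk ((lam : ℂ) * (p - z) / (1 - conj (p : ℂ) * z))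
    (norm_mobius_lt_one p lam z)
  analytic := by
    refine ⟨fun w => (lam : ℂ) * (p - w) / (1 - conj (p : ℂ) * w), ?_, fun _ => rfl⟩
    intro w hw
    have hw' : ‖w‖ < 1 := by simpa using hw
    exact DifferentiableAt.differentiableWithinAt
      (DifferentiableAt.div (by fun_prop) (by fun_prop) (one_sub_conj_mul_ne_zero p hw'.le))

/-- The conjugate-linear map `J W_{ξ_p, τ_p}` on the Hardy space. -/
def JW (p : 𝔻) (lam : Circle) : HardySpace →ₗ⋆[ℂ] HardySpace :=
  hardyConj.comp (weightedComp (xi p) (tau p lam)).toLinearMap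

theorem JW_apply (p : 𝔻) (lam : Circle) (f : HardySpace) (z : 𝔻) :
    JW p lam f z = conj (xi p (star z) * f (tau p lam (star z))) := rfl

section Conjugation

variable {H : Type*} [NormedAddCommGroup H] [InnerProductSpace ℂ H]

/-- A conjugation: a conjugate-linear involution `C` with `⟪C x, C y⟫ = ⟪y, x⟫`. -/
structure IsConjugation (C : H →ₗ⋆[ℂ] H) : Prop where
  inner_map : ∀ x y, ⟪C x, C y⟫_ℂ = ⟪y, x⟫_ℂ
  involutive : ∀ x, C (C x) = x

/-- `T` is `C`-normal: `C` is a conjugation and `C T* T C = T T*`. -/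
def IsCNormal [CompleteSpace H] (C : H →ₗ⋆[ℂ] H) (T : H →L[ℂ] H) : Prop :=
  IsConjugation C ∧
    ∀ x, C (ContinuousLinearMap.adjoint T (T (C x))) = T (ContinuousLinearMap.adjoint T x)

end Conjugation

/-- `φ(z) = (a z + b) / (c z + d)` on the unit disc, where `a d - b c ≠ 0`. -/
structure IsLinearFractional (a b c d : ℂ) (φ : AnalyticSelfMap) : Prop where
  det_ne_zero : a * d - b * c ≠ 0
  denom_ne_zero : ∀ z : 𝔻, c * z + d ≠ 0
  eq : ∀ z : 𝔻, (φ z : ℂ) = (a * z + b) / (c * z + d)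

end HardyDisc

end

/-! Write `K_w` for the Szegő kernel, `T` for the composition operator and `C` for `JW`. One test
vector decides everything. Since `T* K_w = K_{φ(w)}` and `φ(0) = 0`, the constant `K_0 = 1` is fixed
by both `T` and `T*`. On the other hand `C K_0` is a nonzero multiple of `K_{p̄}`. Evaluating `C T*
T C = T T*` at `K_0` therefore gives `T* T K_{p̄} = K_{p̄}`, so `‖T K_{p̄}‖ = ‖K_{p̄}‖`. An isometry
trivially satisfies the same equality.

This single equality forces a rotation. Normalise `φ(z) = Az / (1 + Bz)`; being a self-map of the
disc gives `|A| + |B| ≤ 1`. Then `T K_{p̄} = 1 + pAz / (1 - (pA - B)z)`, whose norm is a geometric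
sum, and for `p ≠ 0` the equality becomes `|A|²(1 - |p|²) = 1 - |pA - B|²`. Together with `|pA - B|
≤ |p||A| + |B|` this yields `|A| = 1` and `B = 0`.

Conversely a rotation makes `T` unitary, and `C T* T C = C² = I = T T*`. That `C` is a conjugation,
which is part of C-normality, is checked on kernels. -/

namespace HardyDisc

/-! ### Szegő kernels and operators determined by them -/

/-- The Szegő kernel at `w`, the function representing the evaluation at `w`. -/
noncomputable def szego (w : 𝔻) : HardySpace := RKHS.kerFun HardySpace w 1

theorem inner_szego (w : 𝔻) (f : HardySpace) : ⟪szego w, f⟫_ℂ = f w := by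
  simp [szego, RKHS.kerFun_inner]

theorem coeffs_eq_of_hasSum {f : HardySpace} {a : ℕ → ℂ} (ha : Summable fun n => ‖a n‖ ^ 2)
    (h : ∀ z : 𝔻, HasSum (fun n => a n * (z : ℂ) ^ n) (f z)) (n : ℕ) :
    HardySpace.coeffs f n = a n := by
  let b : SqSum := ⟨a, SqSum.memℓp_of_summable ha⟩
  have hf : f = HardySpace.ofCoeffs b :=
    RKHS.ext fun z => (h z).unique (hasSum_powerSum b z)
  have hb : HardySpace.coeffs f = b := by
    rw [hf]; exact HardySpace.ofCoeffs.symm_apply_apply b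
  rw [hb]

theorem hasSum_inner_coeffs (f g : HardySpace) :
    HasSum (fun n => HardySpace.coeffs g n * conj (HardySpace.coeffs f n)) ⟪f, g⟫_ℂ := by
  have h := lp.hasSum_inner (𝕜 := ℂ) (HardySpace.coeffs f) (HardySpace.coeffs g)
  simp only [RCLike.inner_apply] at h
  exact h

theorem norm_mul_unitDisc_lt_one {e : ℂ} (he : ‖e‖ ≤ 1) (z : 𝔻) : ‖e * z‖ < 1 := by
  rw [norm_mul]
  nlinarith [z.norm_lt_one, norm_nonneg e, norm_nonneg (z : ℂ)]

/-- The square-summable sequence `w̄ⁿ` represents evaluation at `w`, because pairing it with `f`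
gives the power series of `f` at `w`; its own power series is geometric. -/
theorem szego_apply (w z : 𝔻) : szego w z = (1 - conj (w : ℂ) * z)⁻¹ := by
  have hw : ‖conj (w : ℂ)‖ < 1 := by rw [RCLike.norm_conj]; exact w.norm_lt_one
  have hs : Summable fun n : ℕ => ‖conj (w : ℂ) ^ n‖ ^ 2 := by
    have : (fun n : ℕ => ‖conj (w : ℂ) ^ n‖ ^ 2) = fun n : ℕ => (‖conj (w : ℂ)‖ ^ 2) ^ n := by
      funext n; rw [norm_pow, ← pow_mul, ← pow_mul, mul_comm]
    rw [this]
    exact summable_geometric_of_lt_one (by positivity) (by nlinarith [norm_nonneg (conj (w : ℂ))])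
  let b : SqSum := ⟨fun n => conj (w : ℂ) ^ n, SqSum.memℓp_of_summable hs⟩
  have hb : HardySpace.coeffs (HardySpace.ofCoeffs b) = b :=
    HardySpace.ofCoeffs.symm_apply_apply b
  have hk : szego w = HardySpace.ofCoeffs b := by
    refine ext_inner_right ℂ fun f => ?_
    rw [inner_szego]
    have h := hasSum_inner_coeffs (HardySpace.ofCoeffs b) f
    rw [hb] at h
    have hbn : ∀ n, conj (b n) = (w : ℂ) ^ n := fun n => by
      change conj (conj (w : ℂ) ^ n) = _
      simp
    simp only [hbn] at h
    exact (HardySpace.hasSum_apply f w).unique h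
  rw [hk]
  refine (hasSum_powerSum b z).unique ?_
  have := hasSum_geometric_of_norm_lt_one (norm_mul_unitDisc_lt_one hw.le z)
  simpa [mul_pow] using this

theorem norm_szego_sq (w : 𝔻) : ‖szego w‖ ^ 2 = (1 - ‖(w : ℂ)‖ ^ 2)⁻¹ := by
  have h : (‖szego w‖ : ℂ) ^ 2 = ((1 - ‖(w : ℂ)‖ ^ 2)⁻¹ : ℝ) := by
    have h1 := inner_self_eq_norm_sq_to_K (𝕜 := ℂ) (szego w)
    rw [inner_szego, szego_apply, Complex.conj_mul'] at h1
    push_cast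
    exact h1.symm
  exact_mod_cast h

theorem szego_zero_apply (z : 𝔻) : szego 0 z = 1 := by simp [szego_apply]

/-- The kernels span a dense subspace, since a function orthogonal to all of them vanishes at every
point. -/
theorem continuousLinearMap_ext_szego {S T : HardySpace →L[ℂ] HardySpace}
    (h : ∀ w, S (szego w) = T (szego w)) : S = T := by
  have hd : Dense (Submodule.span ℂ {f : HardySpace | ∃ x v, RKHS.kerFun HardySpace x v = f} :
      Set HardySpace) :=
    (Submodule.dense_iff_topologicalClosure_eq_top).2 (RKHS.kerFun_dense HardySpace)
  refine ContinuousLinearMap.ext_on hd ?_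
  rintro _ ⟨x, v, rfl⟩
  have hv : RKHS.kerFun HardySpace x v = v • szego x := by
    rw [szego, ← map_smul, smul_eq_mul, mul_one]
  rw [hv, map_smul, map_smul, h]

/-- The value of `T* T K_w` at `v` is `⟪T K_v, T K_w⟫`, so preserving the Gram matrix of the kernels
already means `T* T = I`. -/
theorem inner_map_map_of_szego {T : HardySpace →L[ℂ] HardySpace}
    (h : ∀ v w, ⟪T (szego v), T (szego w)⟫_ℂ = szego w v) (f g : HardySpace) :
    ⟪T f, T g⟫_ℂ = ⟪f, g⟫_ℂ := by
  have hT : ContinuousLinearMap.adjoint T ∘L T = ContinuousLinearMap.id ℂ HardySpace :=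
    continuousLinearMap_ext_szego fun w => RKHS.ext fun v => by
      rw [← inner_szego, ContinuousLinearMap.comp_apply, ContinuousLinearMap.adjoint_inner_right,
        h, ContinuousLinearMap.id_apply]
  rw [← ContinuousLinearMap.adjoint_inner_right, ← ContinuousLinearMap.comp_apply, hT,
    ContinuousLinearMap.id_apply]

theorem adjoint_compositionOperator_szego (φ : AnalyticSelfMap) (w : 𝔻) :
    ContinuousLinearMap.adjoint (compositionOperator φ) (szego w) = szego (φ w) := by
  refine ext_inner_right ℂ fun f => ?_
  rw [ContinuousLinearMap.adjoint_inner_left, inner_szego, inner_szego, compositionOperator_apply]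

/-! ### The conjugation `JW` -/

theorem coeffs_hardyConj (f : HardySpace) (n : ℕ) :
    HardySpace.coeffs (hardyConj f) n = conj (HardySpace.coeffs f n) := by
  refine coeffs_eq_of_hasSum (a := fun n => conj (HardySpace.coeffs f n)) ?_ (fun z => ?_) n
  · simpa using (HardySpace.coeffs f).summable_sq
  · have := (Complex.hasSum_conj' (f := fun n => _)).2 (HardySpace.hasSum_apply f (star z))
    simp only [map_mul, map_pow, Complex.UnitDisc.coe_star, Complex.conj_conj] at this
    exact this

theorem inner_hardyConj (f g : HardySpace) : ⟪hardyConj f, hardyConj g⟫_ℂ = ⟪g, f⟫_ℂ := by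
  refine (hasSum_inner_coeffs _ _).unique ?_
  simpa [coeffs_hardyConj, mul_comm] using hasSum_inner_coeffs g f

theorem coe_tau (p : 𝔻) (lam : Circle) (z : 𝔻) :
    (tau p lam z : ℂ) = (lam : ℂ) * (p - z) / (1 - conj (p : ℂ) * z) := rfl

theorem xi_apply (p z : 𝔻) :
    xi p z = (Real.sqrt (1 - ‖(p : ℂ)‖ ^ 2) : ℂ) / (1 - conj (p : ℂ) * z) := rfl

theorem one_sub_norm_sq_ne_zero (p : 𝔻) : 1 - (p : ℂ) * conj (p : ℂ) ≠ 0 := by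
  rw [mul_comm]; exact one_sub_conj_mul_ne_zero p p.norm_lt_one.le

theorem sqrt_mul_self_eq (p : 𝔻) :
    (Real.sqrt (1 - ‖(p : ℂ)‖ ^ 2) : ℂ) * (Real.sqrt (1 - ‖(p : ℂ)‖ ^ 2) : ℂ)
      = 1 - (p : ℂ) * conj (p : ℂ) := by
  rw [← Complex.ofReal_mul, Real.mul_self_sqrt (sub_nonneg.2 p.sq_norm_lt_one.le),
    Complex.mul_conj']
  push_cast
  rfl

theorem conj_mul_circle (lam : Circle) : conj (lam : ℂ) * lam = 1 := by
  rw [Complex.conj_mul', Circle.norm_coe]; simp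

theorem conj_circle_mul_conj {p : 𝔻} {lam : Circle} (hlam : (lam : ℂ) * p = conj (p : ℂ)) :
    conj (lam : ℂ) * conj (p : ℂ) = p := by
  rw [← hlam, ← mul_assoc, conj_mul_circle, one_mul]

/-- Two applications of `JW` evaluate a function at `τ(σ(z))`, where `σ(z)` is the conjugate of
`τ(z̄)`. The relation `λp = p̄` brings `σ` to this form. -/
theorem coe_star_tau_star {p : 𝔻} {lam : Circle} (hlam : (lam : ℂ) * p = conj (p : ℂ)) (z : 𝔻) :
    ((star (tau p lam (star z)) : 𝔻) : ℂ) = (p - conj (lam : ℂ) * z) / (1 - p * z) := by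
  rw [Complex.UnitDisc.coe_star, coe_tau]
  simp only [map_div₀, map_mul, map_sub, map_one, Complex.UnitDisc.coe_star, Complex.conj_conj]
  rw [mul_sub, conj_circle_mul_conj hlam]

theorem one_sub_mul_ne_zero (p z : 𝔻) : 1 - (p : ℂ) * z ≠ 0 := by
  simpa using one_sub_conj_mul_ne_zero (star p) z.norm_lt_one.le

theorem one_sub_conj_mul_star_tau_star {p : 𝔻} {lam : Circle}
    (hlam : (lam : ℂ) * p = conj (p : ℂ)) (z : 𝔻) :
    1 - conj (p : ℂ) * (star (tau p lam (star z)) : 𝔻)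
      = (1 - p * conj (p : ℂ)) / (1 - p * z) := by
  have h1 := one_sub_mul_ne_zero p z
  rw [coe_star_tau_star hlam]
  field_simp
  linear_combination (z : ℂ) * conj_circle_mul_conj hlam

/-- Numerator and denominator of `τ(σ(z))` are `z(1 - |p|²)` and `1 - |p|²` over the common factor
`1 - pz`; the numerator uses both `|λ| = 1` and `λp = p̄`. -/
theorem tau_star_tau_star {p : 𝔻} {lam : Circle} (hlam : (lam : ℂ) * p = conj (p : ℂ)) (z : 𝔻) :
    tau p lam (star (tau p lam (star z))) = z := by
  have h1 := one_sub_mul_ne_zero p z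
  have hP := one_sub_norm_sq_ne_zero p
  apply Complex.UnitDisc.coe_injective
  rw [coe_tau, one_sub_conj_mul_star_tau_star hlam, coe_star_tau_star hlam]
  field_simp
  linear_combination (z : ℂ) * conj_mul_circle lam - z * p * hlam

theorem conj_xi_star_apply (p z : 𝔻) :
    conj (xi p (star z)) = (Real.sqrt (1 - ‖(p : ℂ)‖ ^ 2) : ℂ) / (1 - p * z) := by
  simp [xi_apply]

/-- The two denominators multiply to `1 - |p|²`, which the two square roots cancel: this is the
reason for the normalisation of `ξ_p`. -/
theorem conj_xi_star_mul_xi {p : 𝔻} {lam : Circle} (hlam : (lam : ℂ) * p = conj (p : ℂ)) (z : 𝔻) :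
    conj (xi p (star z)) * xi p (star (tau p lam (star z))) = 1 := by
  have h1 := one_sub_mul_ne_zero p z
  have hP := one_sub_norm_sq_ne_zero p
  rw [conj_xi_star_apply, xi_apply, one_sub_conj_mul_star_tau_star hlam]
  field_simp
  linear_combination sqrt_mul_self_eq p

theorem JW_involutive {p : 𝔻} {lam : Circle} (hlam : (lam : ℂ) * p = conj (p : ℂ))
    (f : HardySpace) : JW p lam (JW p lam f) = f := by
  refine RKHS.ext fun z => ?_
  have hx := conj_xi_star_mul_xi hlam z
  rw [JW_apply, JW_apply, map_mul, Complex.conj_conj, tau_star_tau_star hlam, ← mul_assoc, hx,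
    one_mul]

/-- With `s = √(1 - |p|²)`, both sides at `z` equal `s / (1 - p̄z - w̄p̄ + λw̄z)`, an expression
symmetric in `z` and `w̄`; the symmetry needs `λp = p̄`. -/
theorem weightedComp_szego {p : 𝔻} {lam : Circle}
    (hlam : (lam : ℂ) * p = conj (p : ℂ)) (w : 𝔻) :
    weightedComp (xi p) (tau p lam) (szego w)
      = xi p (star w) • szego (star (tau p lam (star w))) := by
  refine RKHS.ext fun z => ?_
  have h1 : 1 - conj (p : ℂ) * z ≠ 0 := one_sub_conj_mul_ne_zero p z.norm_lt_one.le
  have h2 : 1 - conj (p : ℂ) * conj (w : ℂ) ≠ 0 :=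
    one_sub_conj_mul_ne_zero p (by rw [RCLike.norm_conj]; exact w.norm_lt_one.le)
  have h3 := one_sub_conj_mul_ne_zero w (tau p lam z).norm_lt_one.le
  have h4 : 1 - conj (w : ℂ) * (tau p lam z)
      = (1 - conj (p : ℂ) * z - conj (w : ℂ) * conj (p : ℂ) + lam * conj (w : ℂ) * z)
        / (1 - conj (p : ℂ) * z) := by
    rw [coe_tau, eq_div_iff h1, sub_mul, one_mul, mul_assoc, div_mul_cancel₀ _ h1]
    linear_combination -conj (w : ℂ) * hlam
  have h5 : 1 - conj ((star (tau p lam (star w)) : 𝔻) : ℂ) * z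
      = (1 - conj (p : ℂ) * z - conj (w : ℂ) * conj (p : ℂ) + lam * conj (w : ℂ) * z)
        / (1 - conj (p : ℂ) * conj (w : ℂ)) := by
    rw [Complex.UnitDisc.coe_star, Complex.conj_conj, coe_tau, Complex.UnitDisc.coe_star,
      eq_div_iff h2, sub_mul, one_mul, mul_right_comm, div_mul_cancel₀ _ h2]
    linear_combination -(z : ℂ) * hlam
  rw [h4] at h3
  have h6 := (div_ne_zero_iff.1 h3).1
  rw [weightedComp_apply, RKHS.coe_smul, Pi.smul_apply, smul_eq_mul, szego_apply, szego_apply, h4,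
    h5, xi_apply, xi_apply, Complex.UnitDisc.coe_star]
  field_simp

theorem isConjugation_JW {p : 𝔻} {lam : Circle} (hlam : (lam : ℂ) * p = conj (p : ℂ)) :
    IsConjugation (JW p lam) where
  inner_map f g := by
    -- The weighted composition operator preserves the Gram matrix of the kernels. The arguments are
    -- taken in the order `g`, `f` because `J` reverses the inner product.
    have hW := inner_map_map_of_szego (T := weightedComp (xi p) (tau p lam)) (fun v w => by
      rw [weightedComp_szego hlam v, inner_smul_left, inner_szego, weightedComp_apply,
        tau_star_tau_star hlam, ← mul_assoc, conj_xi_star_mul_xi hlam, one_mul]) g f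
    exact (inner_hardyConj _ _).trans hW
  involutive := JW_involutive hlam

/-! ### Composition operators whose symbol is linear fractional -/

theorem compositionOperator_szego_zero (φ : AnalyticSelfMap) :
    compositionOperator φ (szego 0) = szego 0 :=
  RKHS.ext fun z => by rw [compositionOperator_apply, szego_zero_apply, szego_zero_apply]

theorem JW_szego_zero (p : 𝔻) (lam : Circle) :
    JW p lam (szego 0) = (Real.sqrt (1 - ‖(p : ℂ)‖ ^ 2) : ℂ) • szego (star p) :=
  RKHS.ext fun z => by
    rw [JW_apply, szego_zero_apply, mul_one, conj_xi_star_apply, RKHS.coe_smul, Pi.smul_apply,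
      szego_apply, smul_eq_mul, div_eq_mul_inv, Complex.UnitDisc.coe_star, Complex.conj_conj]

/-- C-normality at `K_0` reads `C T* T C K_0 = K_0`. Applying `C` and dividing by the scalar in `C
K_0` gives `T* T K_{p̄} = K_{p̄}`; pairing with `K_{p̄}` gives the norms. -/
theorem norm_compositionOperator_szego_of_isCNormal {p : 𝔻} {lam : Circle} {φ : AnalyticSelfMap}
    (h0 : φ 0 = 0) (h : IsCNormal (JW p lam) (compositionOperator φ)) :
    ‖compositionOperator φ (szego (star p))‖ = ‖szego (star p)‖ := by
  obtain ⟨hC, h⟩ := h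
  have h1 := h (szego 0)
  rw [adjoint_compositionOperator_szego, h0, compositionOperator_szego_zero] at h1
  have h2 := congrArg (JW p lam) h1
  have hs : (Real.sqrt (1 - ‖(p : ℂ)‖ ^ 2) : ℂ) ≠ 0 := by
    rw [Complex.ofReal_ne_zero]
    exact (Real.sqrt_pos.2 (sub_pos.2 p.sq_norm_lt_one)).ne'
  rw [hC.involutive, JW_szego_zero, map_smul, map_smul] at h2
  have h3 := smul_right_injective _ hs h2
  have h4 : (‖compositionOperator φ (szego (star p))‖ : ℂ) ^ 2 = (‖szego (star p)‖ : ℂ) ^ 2 := by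
    have e1 := inner_self_eq_norm_sq_to_K (𝕜 := ℂ) (compositionOperator φ (szego (star p)))
    have e2 := inner_self_eq_norm_sq_to_K (𝕜 := ℂ) (szego (star p))
    rw [← ContinuousLinearMap.adjoint_inner_right, h3] at e1
    exact e1.symm.trans e2
  have h5 : ‖compositionOperator φ (szego (star p))‖ ^ 2 = ‖szego (star p)‖ ^ 2 := by
    exact_mod_cast h4
  exact (sq_eq_sq₀ (norm_nonneg _) (norm_nonneg _)).1 h5

/-- A rotation permutes the kernels, `K_v ∘ φ = K_{ᾱv}`, and leaves their Gram matrix unchanged. -/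
theorem isometry_compositionOperator_of_rotation {φ : AnalyticSelfMap} {α : ℂ} (hα : ‖α‖ = 1)
    (h : ∀ z : 𝔻, (φ z : ℂ) = α * z) : Isometry (compositionOperator φ) := by
  have hαα : conj α * α = 1 := by rw [Complex.conj_mul', hα]; simp
  have hK : ∀ v : 𝔻, compositionOperator φ (szego v)
      = szego (Complex.UnitDisc.mk (conj α * v)
          (norm_mul_unitDisc_lt_one (by rw [RCLike.norm_conj, hα]) v)) := by
    intro v
    refine RKHS.ext fun z => ?_
    rw [compositionOperator_apply, szego_apply, szego_apply, h, Complex.UnitDisc.coe_mk, map_mul,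
      Complex.conj_conj]
    ring_nf
  have hi := inner_map_map_of_szego (T := compositionOperator φ) (fun v w => by
    rw [hK v, inner_szego, compositionOperator_apply, szego_apply, szego_apply, h,
      Complex.UnitDisc.coe_mk, ← mul_assoc α, mul_comm α, hαα, one_mul])
  refine AddMonoidHomClass.isometry_of_norm _ fun f => ?_
  rw [norm_eq_sqrt_re_inner (𝕜 := ℂ), norm_eq_sqrt_re_inner (𝕜 := ℂ), hi]

theorem isCNormal_of_rotation {p : 𝔻} {lam : Circle} (hlam : (lam : ℂ) * p = conj (p : ℂ))
    {φ : AnalyticSelfMap} {α : ℂ} (hα : ‖α‖ = 1) (h : ∀ z : 𝔻, (φ z : ℂ) = α * z) :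
    IsCNormal (JW p lam) (compositionOperator φ) := by
  have hαα : conj α * α = 1 := by rw [Complex.conj_mul', hα]; simp
  have h1 : ContinuousLinearMap.adjoint (compositionOperator φ) ∘L compositionOperator φ
      = ContinuousLinearMap.id ℂ HardySpace :=
    (ContinuousLinearMap.norm_map_iff_adjoint_comp_self _).1 fun f =>
      (isometry_compositionOperator_of_rotation hα h).norm_map_of_map_zero (map_zero _) f
  have h2 : compositionOperator φ ∘L ContinuousLinearMap.adjoint (compositionOperator φ)
      = ContinuousLinearMap.id ℂ HardySpace :=
    continuousLinearMap_ext_szego fun w => RKHS.ext fun z => by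
      rw [ContinuousLinearMap.comp_apply, adjoint_compositionOperator_szego,
        compositionOperator_apply, szego_apply, ContinuousLinearMap.id_apply, szego_apply, h, h,
        map_mul, mul_mul_mul_comm, hαα, one_mul]
  refine ⟨isConjugation_JW hlam, fun f => ?_⟩
  rw [← ContinuousLinearMap.comp_apply, ← ContinuousLinearMap.comp_apply, h1, h2,
    ContinuousLinearMap.id_apply, ContinuousLinearMap.id_apply, JW_involutive hlam]

/-! ### Rigidity of linear fractional symbols fixing the origin -/

/-- The Taylor coefficients are `1, q, qe, qe², …`, so the squared moduli after the first form a
geometric series. -/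
theorem norm_sq_eq_of_apply_eq {f : HardySpace} {q e : ℂ} (he : ‖e‖ < 1)
    (h : ∀ z : 𝔻, f z = 1 + q * z / (1 - e * z)) :
    ‖f‖ ^ 2 = 1 + ‖q‖ ^ 2 / (1 - ‖e‖ ^ 2) := by
  obtain ⟨a, ha0, ha1⟩ : ∃ a : ℕ → ℂ, a 0 = 1 ∧ ∀ n, a (n + 1) = q * e ^ n :=
    ⟨fun n => Nat.casesOn n 1 fun k => q * e ^ k, rfl, fun _ => rfl⟩
  have hs : HasSum (fun n => ‖a n‖ ^ 2) (1 + ‖q‖ ^ 2 / (1 - ‖e‖ ^ 2)) := by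
    have hg : HasSum (fun n => ‖a (n + 1)‖ ^ 2) (‖q‖ ^ 2 / (1 - ‖e‖ ^ 2)) := by
      have h1 : (fun n => ‖a (n + 1)‖ ^ 2) = fun n => ‖q‖ ^ 2 * (‖e‖ ^ 2) ^ n := by
        funext n
        rw [ha1, norm_mul, norm_pow, mul_pow, ← pow_mul, ← pow_mul, mul_comm 2 n]
      rw [h1, div_eq_mul_inv]
      exact (hasSum_geometric_of_lt_one (sq_nonneg ‖e‖)
        (by nlinarith [norm_nonneg e])).mul_left (‖q‖ ^ 2)
    have h2 := HasSum.zero_add (f := fun n => ‖a n‖ ^ 2) hg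
    rwa [ha0, norm_one, one_pow] at h2
  have hc := coeffs_eq_of_hasSum (f := f) hs.summable fun z => by
    have h1 := (hasSum_geometric_of_norm_lt_one
      (norm_mul_unitDisc_lt_one he.le z)).mul_left (q * z)
    have h2 : (fun n => a (n + 1) * (z : ℂ) ^ (n + 1)) = fun n => q * z * (e * z) ^ n := by
      funext n
      rw [ha1]
      ring
    rw [← h2, ← div_eq_mul_inv] at h1
    have h3 := HasSum.zero_add (f := fun n => a n * (z : ℂ) ^ n) h1
    rwa [ha0, pow_zero, one_mul, ← h z] at h3
  rw [HardySpace.norm_sq_eq]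
  simp only [hc]
  exact hs.tsum_eq

/-- If `s = |A| + |B| > 1`, the point of modulus `1/s` pointing towards the pole lies in the disc,
and there the denominator is `|A|/s`, so the value has modulus exactly `1`. -/
theorem norm_add_norm_le_one_of_forall {A B : ℂ} (hA : A ≠ 0)
    (h : ∀ z : 𝔻, ‖A * z / (1 + B * z)‖ < 1) : ‖A‖ + ‖B‖ ≤ 1 := by
  obtain ⟨u, hu, hBu⟩ : ∃ u : ℂ, ‖u‖ = 1 ∧ B * u = -(‖B‖ : ℂ) := by
    rcases eq_or_ne B 0 with rfl | hB0
    · exact ⟨1, by simp, by simp⟩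
    · have hn : (‖B‖ : ℂ) ≠ 0 := by simpa using hB0
      refine ⟨-(‖B‖ : ℂ) / B, ?_, mul_div_cancel₀ _ hB0⟩
      rw [norm_div, norm_neg, Complex.norm_real, norm_norm, div_self (norm_ne_zero_iff.2 hB0)]
  have hA0 := norm_pos_iff.2 hA
  by_contra! hlt
  set s := ‖A‖ + ‖B‖ with hs
  have hs0 : 0 < s := by linarith
  have hz : ‖(s⁻¹ : ℝ) * u‖ < 1 := by
    rw [norm_mul, hu, mul_one, Complex.norm_real, Real.norm_of_nonneg (inv_nonneg.2 hs0.le)]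
    exact inv_lt_one_of_one_lt₀ hlt
  have h1 := h (Complex.UnitDisc.mk _ hz)
  have h2 : 1 + B * ((s⁻¹ : ℝ) * u) = ((‖A‖ * s⁻¹ : ℝ) : ℂ) := by
    have h3 : (1 : ℂ) = ((s * s⁻¹ : ℝ) : ℂ) := by rw [mul_inv_cancel₀ hs0.ne']; simp
    rw [mul_left_comm, hBu, h3, hs]
    push_cast
    ring
  rw [Complex.UnitDisc.coe_mk, h2, norm_div, norm_mul, norm_mul, hu, mul_one, Complex.norm_real,
    Complex.norm_real, norm_mul, norm_norm, div_self] at h1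
  · exact lt_irrefl _ h1
  · exact mul_ne_zero hA0.ne' (norm_ne_zero_iff.2 (inv_ne_zero hs0.ne'))

theorem exists_rotation_of_norm_szego_eq {p : 𝔻} (hp : p ≠ 0) {a b c d : ℂ} {φ : AnalyticSelfMap}
    (hφ : IsLinearFractional a b c d φ) (h0 : φ 0 = 0)
    (h : ‖compositionOperator φ (szego (star p))‖ = ‖szego (star p)‖) :
    ∃ α : ℂ, ‖α‖ = 1 ∧ ∀ z : 𝔻, (φ z : ℂ) = α * z := by
  have hd : d ≠ 0 := by simpa using hφ.denom_ne_zero 0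
  have hb : b = 0 := by
    have := hφ.eq 0
    rw [h0] at this
    simpa [hd, eq_comm] using this
  have ha : a ≠ 0 := by
    rintro rfl
    exact hφ.det_ne_zero (by simp [hb])
  subst hb
  have hA : a / d ≠ 0 := div_ne_zero ha hd
  have hden : ∀ z : 𝔻, 1 + c / d * z ≠ 0 := fun z h => hφ.denom_ne_zero z (by
    field_simp at h
    linear_combination h)
  have hval : ∀ z : 𝔻, (φ z : ℂ) = a / d * z / (1 + c / d * z) := fun z => by
    have h1 := hφ.denom_ne_zero z
    have h2 := hden z
    rw [hφ.eq]
    have h3 : 1 + c / d * (z : ℂ) = (c * z + d) / d := by field_simp; ring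
    rw [h3]
    field_simp
    ring
  generalize a / d = A at *
  generalize c / d = B at *
  have hAB : ‖A‖ + ‖B‖ ≤ 1 :=
    norm_add_norm_le_one_of_forall hA fun z => by rw [← hval]; exact (φ z).norm_lt_one
  have hp1 := p.norm_lt_one
  have hp0 : 0 < ‖(p : ℂ)‖ := norm_pos_iff.2 (by simpa using hp)
  have hA0 := norm_pos_iff.2 hA
  have he' : ‖(p : ℂ) * A - B‖ ≤ ‖(p : ℂ)‖ * ‖A‖ + ‖B‖ := by
    rw [← norm_mul]; exact norm_sub_le _ _
  -- Strict because `|p| < 1` and `A ≠ 0`, while `|A| + |B| ≤ 1`.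
  have he : ‖(p : ℂ) * A - B‖ < 1 := by nlinarith
  -- `1 / (1 - pφ(z)) = (1 + Bz) / (1 - (pA - B)z)`; splitting off the constant term `1` leaves the
  -- numerator `pAz`.
  have hn := norm_sq_eq_of_apply_eq (f := compositionOperator φ (szego (star p)))
    (q := p * A) he fun z => by
      have h1 := hden z
      have h2 : 1 - (p : ℂ) * φ z = (1 - (p * A - B) * z) / (1 + B * z) := by
        rw [hval, eq_div_iff h1, sub_mul, one_mul, mul_assoc, div_mul_cancel₀ _ h1]
        ring
      have h3 : 1 - (p * A - B) * z ≠ 0 :=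
        (div_ne_zero_iff.1 (h2 ▸ one_sub_mul_ne_zero p (φ z))).1
      rw [compositionOperator_apply, szego_apply, Complex.UnitDisc.coe_star, Complex.conj_conj, h2,
        inv_div, div_eq_iff h3, add_mul, div_mul_cancel₀ _ h3]
      ring
  rw [h, norm_szego_sq, Complex.UnitDisc.coe_star, RCLike.norm_conj, norm_mul, mul_pow] at hn
  have hP : 0 < 1 - ‖(p : ℂ)‖ ^ 2 := sub_pos.2 p.sq_norm_lt_one
  have hE : 0 < 1 - ‖(p : ℂ) * A - B‖ ^ 2 := by nlinarith [norm_nonneg ((p : ℂ) * A - B)]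
  have hkey : ‖A‖ ^ 2 * (1 - ‖(p : ℂ)‖ ^ 2) = 1 - ‖(p : ℂ) * A - B‖ ^ 2 := by
    field_simp at hn
    -- Here `p ≠ 0` is essential: for `p = 0` the test kernel is the constant `1` and the norm
    -- equality says nothing.
    have hp2 : ‖(p : ℂ)‖ ^ 2 ≠ 0 := by positivity
    apply mul_left_cancel₀ hp2
    linarith
  have hA1 : ‖A‖ = 1 := by
    refine le_antisymm (by linarith [norm_nonneg B]) ?_
    -- Put `t = |A|(1 - |p|)`. Then `hkey` and `|pA - B| ≤ 1 - t` give `2t - t² ≤ t|A|(1 + |p|)`,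
    -- that is `2t(1 - |A|) ≤ 0`, which contradicts `|A| < 1` since `t > 0`.
    have h1 : ‖(p : ℂ) * A - B‖ ≤ 1 - ‖A‖ * (1 - ‖(p : ℂ)‖) := by linarith
    have h2 : ‖(p : ℂ) * A - B‖ ^ 2 ≤ (1 - ‖A‖ * (1 - ‖(p : ℂ)‖)) ^ 2 := by gcongr
    have h3 : 0 < ‖A‖ * (1 - ‖(p : ℂ)‖) := mul_pos hA0 (by linarith)
    by_contra! hlt
    have h4 : 0 < ‖A‖ * (1 - ‖(p : ℂ)‖) * (1 - ‖A‖) := mul_pos h3 (by linarith)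
    nlinarith
  have hB : B = 0 := norm_le_zero_iff.1 (by linarith)
  exact ⟨A, hA1, fun z => by rw [hval, hB]; simp⟩

end HardyDisc

theorem mainTheorem2 (p : 𝔻) (hp : p ≠ 0) (lam : Circle)
    (hlam : (lam : ℂ) * (p : ℂ) = conj (p : ℂ))
    (a b c d : ℂ) (φ : HardyDisc.AnalyticSelfMap)
    (hφ : HardyDisc.IsLinearFractional a b c d φ) (h0 : φ 0 = 0) :
    (HardyDisc.IsCNormal (HardyDisc.JW p lam) (HardyDisc.compositionOperator φ) ↔
        Isometry (HardyDisc.compositionOperator φ)) ∧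
      (Isometry (HardyDisc.compositionOperator φ) ↔
        ∃ α : ℂ, ‖α‖ = 1 ∧ ∀ z : 𝔻, (φ z : ℂ) = α * z) := by
  have h1 : Isometry (HardyDisc.compositionOperator φ) ↔
      ∃ α : ℂ, ‖α‖ = 1 ∧ ∀ z : 𝔻, (φ z : ℂ) = α * z :=
    -- Of the isometry property only norm preservation at `K_{p̄}` is used.
    ⟨fun h => HardyDisc.exists_rotation_of_norm_szego_eq hp hφ h0
      (h.norm_map_of_map_zero (map_zero _) _),
    fun ⟨_, hα, h⟩ => HardyDisc.isometry_compositionOperator_of_rotation hα h⟩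
  refine ⟨⟨fun h => h1.2 (HardyDisc.exists_rotation_of_norm_szego_eq hp hφ h0
    (HardyDisc.norm_compositionOperator_szego_of_isCNormal h0 h)), fun h => ?_⟩, h1⟩
  obtain ⟨α, hα, h⟩ := h1.1 h
  exact HardyDisc.isCNormal_of_rotation hlam hα h
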